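/- **Setting.** Let $E$ be a Polish space, $h:E\to\mathbb{R}^n$ measurable, and let $(P_t)_{t\ge 0}$ be Markov kernels on $E$ (for instance a transition semigroup). On a probability space $(\Omega,\mathcal{F},\mathbf{P})$ let $(X_t)_{t\in\mathbb{R}}$ be a stationary càdlàg $E$-valued Markov process with transition probabilities $(P_t)$ and stationary law $\pi=\mathbf{P}(X_0\in\cdot\,)$, and let $(B_t)_{t\in\mathbb{R}}$ be a two-sided $n$-dimensional Wiener process independent of $X$. Let $\mu$ be any probability measure on $E$ (not necessarily absolutely continuous with respect to $\pi$), and let $\mathbf{P}^\mu$ be a probability measure, on a possibly different space, under which $(X_t)_{t\ge 0}$ is a càdlàg Markov process with the same transition probabilities $(P_t)$ and initial law $\mu$, and $(B_t)_{t\ge 0}$ is an $n$-dimensional Wiener process independent of $X$. Assume that, almost surely under $\mathbf{P}$ and under $\mathbf{P}^\mu$, $s\mapsto h(X_s)$ is integrable on bounded time intervals. For $\kappa\ge 0$ put $$Y^\kappa_t=\int_0^t h(X_s)\,ds+\kappa B_t,\qquad \mathcal{F}^{Y,\kappa}_{[a,b]}=\sigma\{Y^\kappa_s-Y^\kappa_a: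 s\in[a,b]\},\qquad \mathcal{F}^{Y,\kappa}_{]-\infty,b]}=\bigvee_{a<b}\mathcal{F}^{Y,\kappa}_{[a,b]},$$ and for a measurable function $f:E\to\mathbb{R}$ define $$e^\mu_t(f,\kappa)=\mathbf{E}^\mu\Big(\big\{f(X_t)-\mathbf{E}^\mu\big(f(X_t)\,\big|\,\mathcal{F}^{Y,\kappa}_{[0,t]}\big)\big\}^2\Big),\qquad e(f,\kappa)=\mathbf{E}\Big(\big\{f(X_0)-\mathbf{E}\big(f(X_0)\,\big|\,\mathcal{F}^{Y,\kappa}_{]-\infty,0]}\big)\big\}^2\Big).$$ **Lemma.** Suppose that $\|\mathbf{P}^\mu(X_t\in\cdot\,)-\pi\|_{\rm TV}\to 0$ as $t\to\infty$, and let $f$ be a bounded measurable function. Then, for every $\kappa\ge 0$, $$\limsup_{t\to\infty}\,e^\mu_t(f,\kappa)\le e(f,\kappa).$$ Consequently, if $e(f,\kappa)\to 0$ as $\kappa\downarrow 0$, then $e^\mu_t(f,\kappa)\to 0$ as $t\to\infty$, $\kappa\downarrow 0$ (in that order), that is, $\lim_{\kappa\downarrow 0}\limsup_{t\to\infty}e^\mu_t(f,\kappa)=0$.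 -/

import Mathlib

open MeasureTheory ProbabilityTheory Filter Topology
open scoped NNReal

namespace NonlinearFilter

/-- The sigma-field `σ{Z_s : s ∈ J}` generated by the process `Z` over the time set `J`. -/
def processSigma {Ω G : Type*} [MeasurableSpace G] (Z : ℝ → Ω → G) (J : Set ℝ) :
    MeasurableSpace Ω :=
  ⨆ s ∈ J, MeasurableSpace.comap (Z s) inferInstance

/-- `X`, considered on the time set `I`, is a Markov process (with respect to the filtration it
generates) with time-homogeneous transition probabilities `K t x A`:
`P(X_{s+t} ∈ A | σ{X_r : r ∈ I, r ≤ s}) = K t (X_s) A` almost surely. A transition semigroup is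
the typical `K`; the Chapman-Kolmogorov equations are not imposed separately, since along the process
they hold almost everywhere. -/
def IsMarkovProcess {Ω E : Type*} [MeasurableSpace E] [MeasurableSpace Ω] (I : Set ℝ)
    (K : ℝ≥0 → Kernel E E) (X : ℝ → Ω → E) (P : Measure Ω) : Prop :=
  ∀ s ∈ I, ∀ t : ℝ≥0, s + (t : ℝ) ∈ I → ∀ A : Set E, MeasurableSet A →
    P[(X (s + t) ⁻¹' A).indicator (fun _ => (1 : ℝ)) | processSigma X (I ∩ Set.Iic s)]
      =ᵐ[P] fun ω => (K t (X s ω)).real A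

/-- Right-continuity with left limits of a path `x`, considered on the time set `I`. -/
def IsCadlagOn {E : Type*} [TopologicalSpace E] (I : Set ℝ) (x : ℝ → E) : Prop :=
  ∀ t ∈ I, ContinuousWithinAt x (I ∩ Set.Ici t) t ∧
    ∃ l : E, Tendsto x (𝓝[I ∩ Set.Iio t] t) (𝓝 l)

/-- Strict stationarity of a process indexed by `ℝ`: the law of the whole process is invariant
under time shifts. -/
def IsStationaryProcess {Ω E : Type*} [MeasurableSpace E] [MeasurableSpace Ω]
    (X : ℝ → Ω → E) (P : Measure Ω) : Prop :=
  ∀ r : ℝ, IdentDistrib (fun ω (t : ℝ) => X (t + r) ω) (fun ω (t : ℝ) => X t ω) P P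

/-- `B`, considered on the time set `I`, is a standard `n`-dimensional Wiener process: it starts
from `0` at time `0`, has independent increments with `B_t - B_s ∼ N(0, (t - s) Id)` for `s ≤ t`,
and almost surely continuous paths. For `I = ℝ` this is the two-sided Wiener process. -/
structure IsWienerProcess {Ω : Type*} [MeasurableSpace Ω] {n : ℕ} (I : Set ℝ)
    (B : ℝ → Ω → EuclideanSpace ℝ (Fin n)) (P : Measure Ω) : Prop where
  measurable : ∀ t ∈ I, Measurable (B t)
  zero : ∀ᵐ ω ∂P, B 0 ω = 0
  indep_increments : HasIndepIncrements (fun t : I => B t) P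
  law_increments : ∀ s ∈ I, ∀ t ∈ I, s ≤ t →
    HasLaw (fun ω => B t ω - B s ω)
      (multivariateGaussian 0 ((t - s) • (1 : Matrix (Fin n) (Fin n) ℝ))) P
  continuous_paths : ∀ᵐ ω ∂P, ContinuousOn (fun t => B t ω) I

/-- Standing assumptions on the signal `X` and the noise `B` over the time set `I` (all of `ℝ`, or
`[0, ∞)`): the signal is a càdlàg Markov process with transition probabilities `K`, the noise is a
Wiener process independent of the signal, and the integrals `∫ h(X_s) ds` over bounded time
intervals, through which the observations are defined, exist. Only times in `I` matter. -/
structure IsFilteringModel {Ω E : Type*} [TopologicalSpace E] [MeasurableSpace E]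
    [MeasurableSpace Ω] {n : ℕ} (I : Set ℝ) (K : ℝ≥0 → Kernel E E)
    (h : E → EuclideanSpace ℝ (Fin n)) (X : ℝ → Ω → E)
    (B : ℝ → Ω → EuclideanSpace ℝ (Fin n)) (P : Measure Ω) : Prop where
  measurable_signal : ∀ t ∈ I, Measurable (X t)
  cadlag : ∀ ω, IsCadlagOn I (fun t => X t ω)
  markov : IsMarkovProcess I K X P
  wiener : IsWienerProcess I B P
  indep : IndepFun (fun ω (t : I) => X t ω) (fun ω (t : I) => B t ω) P
  integrable : ∀ᵐ ω ∂P, ∀ a ∈ I, ∀ b ∈ I,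
    IntervalIntegrable (fun s => h (X s ω)) volume a b

/-- The observation process `Y_t = ∫_0^t h(X_s) ds + κ B_t`. -/
noncomputable def observation {Ω E : Type*} {n : ℕ} (h : E → EuclideanSpace ℝ (Fin n))
    (X : ℝ → Ω → E) (B : ℝ → Ω → EuclideanSpace ℝ (Fin n)) (κ : ℝ) (t : ℝ) (ω : Ω) :
    EuclideanSpace ℝ (Fin n) :=
  (∫ s in (0 : ℝ)..t, h (X s ω)) + κ • B t ω

/-- `ℱ^Y_{[a,b]} = σ{Y_s - Y_a : s ∈ [a,b]}`. -/
def obsSigma {Ω : Type*} {n : ℕ} (Y : ℝ → Ω → EuclideanSpace ℝ (Fin n)) (a b : ℝ) :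
    MeasurableSpace Ω :=
  processSigma (fun s ω => Y s ω - Y a ω) (Set.Icc a b)

/-- `ℱ^Y_{]-∞,b]}`, the sigma-field generated by all `ℱ^Y_{[a,b]}` with `a < b`. -/
def obsSigmaPast {Ω : Type*} {n : ℕ} (Y : ℝ → Ω → EuclideanSpace ℝ (Fin n)) (b : ℝ) :
    MeasurableSpace Ω :=
  ⨆ a ∈ Set.Iio b, obsSigma Y a b

/-- The mean square filtering error at time `t`:
`e_t(f, κ) = E({f(X_t) - E(f(X_t) | ℱ^{Y,κ}_{[0,t]})}²)`, expectations being taken under `P`. -/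
noncomputable def filterError {Ω E : Type*} [MeasurableSpace Ω] {n : ℕ} (P : Measure Ω)
    (h : E → EuclideanSpace ℝ (Fin n)) (X : ℝ → Ω → E)
    (B : ℝ → Ω → EuclideanSpace ℝ (Fin n)) (f : E → ℝ) (κ t : ℝ) : ℝ :=
  ∫ ω, (f (X t ω) -
    (P[fun ω' => f (X t ω') | obsSigma (observation h X B κ) 0 t]) ω) ^ 2 ∂P

/-- The stationary filtering error
`e(f, κ) = E({f(X_0) - E(f(X_0) | ℱ^{Y,κ}_{]-∞,0]})}²)`. -/
noncomputable def stationaryError {Ω E : Type*} [MeasurableSpace Ω] {n : ℕ} (P : Measure Ω)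
    (h : E → EuclideanSpace ℝ (Fin n)) (X : ℝ → Ω → E)
    (B : ℝ → Ω → EuclideanSpace ℝ (Fin n)) (f : E → ℝ) (κ : ℝ) : ℝ :=
  ∫ ω, (f (X 0 ω) -
    (P[fun ω' => f (X 0 ω') | obsSigmaPast (observation h X B κ) 0]) ω) ^ 2 ∂P

end NonlinearFilter

/-!
The filter at time `t` has a mean square error at most that of any other estimate of `f(X_t)` built
from the observations on `[0, t]`, in particular of an estimate `g` that looks only at the
observation increments over the last window `[t - r, t]`. Take for `g` the functional that is optimal
for windows of length `r` in the stationary model, truncated at a bound of `|f|`. The error of `g`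
is the expectation of a bounded measurable functional of the signal after time `t - r` and of the
noise increments after time `t - r`. Noise and signal are independent, the law of the noise
increments is the same in both models, and by the Markov property the law of the signal after time
`t - r` depends only on the law of `X_{t - r}`; so replacing the model started from `μ` by the
stationary one costs at most a constant times the total variation distance between the law of
`X_{t - r}` and `π`.
Letting `t → ∞` bounds the upper limit of the filtering error by the stationary error for windows
of length `r` (`IsFilteringModel.integral_sq_sub_condExp_le_add`), and this tends to the stationary
error for the infinite past as `r → ∞`, by Lévy's upward theorem
(`IsFilteringModel.tendsto_windowError`).

Two points need care. The Chapman-Kolmogorov equations are not available for every starting point,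
so there need be no kernel sending a starting point to the law of the whole path. The comparison is
therefore made for the finite-dimensional distributions, which are the images of the initial law
under the kernels `chainKernel`, and then carried over to all measurable sets of paths by
approximation with cylinders (`measure_le_add_of_le_add_cylinder`). Secondly, the observations
involve `∫ h(X_u) du`, which is not a measurable functional for the product sigma-field on the space
of all paths. For càdlàg paths it agrees with `pathIntegral`, which evaluates the path through its
right limits along a countable set of times and is measurable.
-/

namespace NonlinearFilter

open scoped ENNReal symmDiff

/-! ### Comparison of measures up to an additive error, and least squares -/

/-- A finite set of times is visited by a nondecreasing sequence of times that starts from `0`. -/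
theorem exists_monotone_enumeration (J : Finset ℝ≥0) :
    ∃ (τ : ℕ → ℝ≥0) (N : ℕ) (idx : J → ℕ), Monotone τ ∧ τ 0 = 0 ∧
      ∀ j, idx j ≤ N ∧ τ (idx j) = j := by
  classical
  have hcard : (insert 0 J).card = ((insert 0 J).card - 1) + 1 := by
    have : 0 < (insert 0 J).card := Finset.card_pos.2 ⟨0, Finset.mem_insert_self _ _⟩
    omega
  set N := (insert 0 J).card - 1
  let e := (insert 0 J).orderEmbOfFin hcard
  have hsurj : ∀ j : J, ∃ i, e i = j := fun j => by
    have : (j : ℝ≥0) ∈ Set.range e := by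
      rw [Finset.range_orderEmbOfFin]
      exact Finset.mem_insert_of_mem j.2
    exact this
  choose idx hidx using hsurj
  refine ⟨fun i => e ⟨min i N, by omega⟩, N, fun j => idx j, ?_, ?_,
    fun j => ⟨Nat.lt_succ_iff.1 (idx j).2, ?_⟩⟩
  · intro i j hij
    apply e.monotone
    simp only [Fin.mk_le_mk]
    omega
  · have h0 : (0 : ℝ≥0) ∈ Set.range e := by
      rw [Finset.range_orderEmbOfFin]
      exact Finset.mem_insert_self _ _
    obtain ⟨i, hi⟩ := h0
    refine le_antisymm ?_ zero_le
    rw [← hi]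
    apply e.monotone
    simp
  · rw [← hidx j]
    refine congrArg e (Fin.ext ?_)
    exact min_eq_left (Nat.lt_succ_iff.1 (idx j).2)

theorem measure_le_add_totalVariation {S : Type*} [MeasurableSpace S] (μ ν : Measure S)
    [IsFiniteMeasure μ] [IsFiniteMeasure ν] :
    μ ≤ ν + (μ.toSignedMeasure - ν.toSignedMeasure).totalVariation := by
  set s := μ.toSignedMeasure - ν.toSignedMeasure
  refine Measure.le_iff.2 fun A hA => ?_
  have h1 := (Real.le_norm_self _).trans (SignedMeasure.norm_le_totalVariation s A)
  have h2 : s A = μ.real A - ν.real A := by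
    simp [s, hA]
  rw [h2] at h1
  rw [Measure.add_apply, ← ENNReal.toReal_le_toReal (by finiteness) (by finiteness),
    ENNReal.toReal_add (by finiteness) (by finiteness)]
  simp only [Measure.real] at h1
  linarith

/-- An inequality between measures on a product space, up to an additive error, extends from the
finite-dimensional distributions to all measurable sets, since cylinders approximate these in
measure. -/
theorem measure_le_add_of_le_add_cylinder {ι : Type*} {S : Type*} [MeasurableSpace S]
    (μ ν : Measure (ι → S)) [IsFiniteMeasure μ] [IsFiniteMeasure ν] (δ : ℝ≥0∞)
    (h : ∀ (J : Finset ι) (C : Set (J → S)), MeasurableSet C →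
      μ.map J.restrict C ≤ ν.map J.restrict C + δ)
    {A : Set (ι → S)} (hA : MeasurableSet A) : μ A ≤ ν A + δ := by
  refine ENNReal.le_of_forall_pos_le_add fun ε hε _ => ?_
  have hring : IsSetRing (measurableCylinders fun _ : ι => S) :=
    ⟨empty_mem_measurableCylinders _, fun _ _ => union_mem_measurableCylinders,
      fun _ _ => sdiff_mem_measurableCylinders⟩
  obtain ⟨C, hC, hCA⟩ := exists_measure_symmDiff_lt_of_generateFrom_isSetRing (μ := μ + ν)
    hring ⟨{Set.univ}, Set.countable_singleton _, by
      simpa using univ_mem_measurableCylinders (fun _ : ι => S), by simp⟩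
    generateFrom_measurableCylinders.symm hA (ε := (ε : ℝ≥0∞) / 2) (by simpa using hε.ne')
  obtain ⟨J, D, hD, rfl⟩ := (mem_measurableCylinders C).1 hC
  have hcyl := h J D hD
  rw [Measure.map_apply (Finset.measurable_restrict J) hD,
    Measure.map_apply (Finset.measurable_restrict J) hD] at hcyl
  change μ (cylinder (α := fun _ => S) J D) ≤ ν (cylinder (α := fun _ => S) J D) + δ at hcyl
  set C := cylinder (α := fun _ => S) J D
  have hμ : μ (C ∆ A) ≤ ε / 2 := le_trans (by simp) hCA.le
  have hν : ν (C ∆ A) ≤ ε / 2 := le_trans (by simp) hCA.le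
  calc μ A ≤ μ (C ∪ C ∆ A) := measure_mono (by intro x; simp [symmDiff]; tauto)
    _ ≤ μ C + μ (C ∆ A) := measure_union_le _ _
    _ ≤ (ν C + δ) + ε / 2 := by gcongr
    _ ≤ (ν (A ∪ C ∆ A) + δ) + ε / 2 := by
      gcongr; intro x; simp [symmDiff]; tauto
    _ ≤ (ν A + ε / 2 + δ) + ε / 2 := by
      gcongr; exact (measure_union_le _ _).trans (by gcongr)
    _ = ν A + δ + (ε / 2 + ε / 2) := by ring
    _ = ν A + δ + ε := by rw [ENNReal.add_halves]

theorem prod_le_add_of_le_add {S T : Type*} [MeasurableSpace S] [MeasurableSpace T]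
    (μ ν : Measure S) [SFinite μ] [SFinite ν] (W : Measure T) [IsProbabilityMeasure W] (δ : ℝ≥0∞)
    (h : ∀ A, MeasurableSet A → μ A ≤ ν A + δ) {A : Set (S × T)} (hA : MeasurableSet A) :
    μ.prod W A ≤ ν.prod W A + δ := by
  rw [Measure.prod_apply_symm hA, Measure.prod_apply_symm hA]
  calc ∫⁻ y, μ ((fun x => (x, y)) ⁻¹' A) ∂W
      ≤ ∫⁻ y, (ν ((fun x => (x, y)) ⁻¹' A) + δ) ∂W :=
        lintegral_mono fun y => h _ (measurable_prodMk_right hA)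
    _ = _ := by
      rw [lintegral_add_right _ measurable_const]
      simp

theorem integral_le_add_of_measure_le_add {S : Type*} [MeasurableSpace S]
    (μ ν : Measure S) [IsProbabilityMeasure μ] [IsProbabilityMeasure ν] {δ : ℝ}
    (h : ∀ A, MeasurableSet A → μ A ≤ ν A + ENNReal.ofReal δ) (hδ : 0 ≤ δ)
    {Ψ : S → ℝ} (hΨ : Measurable Ψ) {M : ℝ} (h0 : ∀ x, 0 ≤ Ψ x) (hM : ∀ x, Ψ x ≤ M) :
    ∫ x, Ψ x ∂μ ≤ ∫ x, Ψ x ∂ν + M * δ := by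
  have hint : ∀ (ρ : Measure S) [IsProbabilityMeasure ρ], Integrable Ψ ρ := fun ρ _ =>
    Integrable.of_bound hΨ.aestronglyMeasurable M
      (ae_of_all _ fun x => by rw [Real.norm_of_nonneg (h0 x)]; exact hM x)
  have hM0 : 0 ≤ M := by
    obtain ⟨x⟩ := nonempty_of_isProbabilityMeasure μ
    exact (h0 x).trans (hM x)
  rw [(hint μ).integral_eq_integral_Ioc_meas_le (ae_of_all _ h0) (ae_of_all _ hM),
    (hint ν).integral_eq_integral_Ioc_meas_le (ae_of_all _ h0) (ae_of_all _ hM)]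
  have hanti : ∀ (ρ : Measure S) [IsProbabilityMeasure ρ],
      IntegrableOn (fun t => ρ.real {a | t ≤ Ψ a}) (Set.Ioc 0 M) := fun ρ _ => by
    have : Antitone fun t => ρ.real {a | t ≤ Ψ a} := fun s t hst =>
      measureReal_mono fun a (ha : t ≤ Ψ a) => hst.trans ha
    exact ((this.antitoneOn _).integrableOn_isCompact isCompact_Icc).mono_set
      Set.Ioc_subset_Icc_self
  calc ∫ t in Set.Ioc 0 M, μ.real {a | t ≤ Ψ a}
      ≤ ∫ t in Set.Ioc 0 M, (ν.real {a | t ≤ Ψ a} + δ) := by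
        refine integral_mono (hanti μ) ((hanti ν).add (integrable_const _)) fun t => ?_
        have := h _ (measurableSet_le measurable_const hΨ : MeasurableSet {a | t ≤ Ψ a})
        rw [← ENNReal.toReal_le_toReal (by finiteness) (by finiteness),
          ENNReal.toReal_add (by finiteness) (by finiteness), ENNReal.toReal_ofReal hδ] at this
        exact this
    _ = _ := by
      rw [integral_add (hanti ν) (integrable_const _)]
      simp [hM0]

/-- The conditional expectation is the best mean square approximation, stated for bounded
variables. -/
theorem integral_sq_sub_condExp_le {Ω : Type*} {m m0 : MeasurableSpace Ω} (hm : m ≤ m0)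
    (P : Measure Ω) [IsProbabilityMeasure P] {ξ g : Ω → ℝ} (hξ : Measurable ξ)
    (hg : Measurable[m] g) {C : ℝ} (hξC : ∀ ω, |ξ ω| ≤ C) (hgC : ∀ ω, |g ω| ≤ C) :
    ∫ ω, (ξ ω - (P[ξ | m]) ω) ^ 2 ∂P ≤ ∫ ω, (ξ ω - g ω) ^ 2 ∂P := by
  have hC : 0 ≤ C := by
    obtain ⟨ω⟩ := nonempty_of_isProbabilityMeasure P
    exact (abs_nonneg _).trans (hξC ω)
  have hξi : Integrable ξ P := Integrable.of_bound hξ.aestronglyMeasurable C (ae_of_all _ hξC)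
  set η := P[ξ | m]
  have hηm : StronglyMeasurable[m] η := stronglyMeasurable_condExp
  have hη : AEStronglyMeasurable η P := (hηm.mono hm).aestronglyMeasurable
  have hηC : ∀ᵐ ω ∂P, |η ω| ≤ C :=
    ae_bdd_abs_condExp_of_ae_bdd_abs (ae_of_all _ hξC)
  have hgm : AEStronglyMeasurable g P := (hg.mono hm le_rfl).aestronglyMeasurable
  -- the residual `ξ - η` is orthogonal to the `m`-measurable variable `η - g`
  have hcross : ∫ ω, (ξ ω - η ω) * (η ω - g ω) ∂P = 0 := by
    have hi : Integrable (fun ω => ξ ω - η ω) P := hξi.sub integrable_condExp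
    have hsub : StronglyMeasurable[m] (fun ω => η ω - g ω) := hηm.sub hg.stronglyMeasurable
    have hprod : Integrable ((fun ω => ξ ω - η ω) * (fun ω => η ω - g ω)) P := by
      refine hi.mul_bdd (c := C + C) (hsub.mono hm).aestronglyMeasurable ?_
      filter_upwards [hηC] with ω h1
      exact (norm_sub_le _ _).trans (add_le_add h1 (hgC ω))
    have h1 := condExp_mul_of_stronglyMeasurable_right hsub hprod hi
    have h2 : P[fun ω => ξ ω - η ω | m] =ᵐ[P] 0 := by
      refine (condExp_sub hξi integrable_condExp m).trans ?_
      rw [condExp_of_stronglyMeasurable hm hηm integrable_condExp]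
      simp [η]
    calc ∫ ω, (ξ ω - η ω) * (η ω - g ω) ∂P
        = ∫ ω, (P[(fun ω => ξ ω - η ω) * (fun ω => η ω - g ω) | m]) ω ∂P :=
          (integral_condExp hm).symm
      _ = ∫ ω, (0 : ℝ) ∂P := by
        refine integral_congr_ae ?_
        filter_upwards [h1, h2] with ω h1 h2
        rw [h1, Pi.mul_apply, h2]
        simp
      _ = 0 := by simp
  have hsqi : ∀ {u v : Ω → ℝ}, AEStronglyMeasurable u P → AEStronglyMeasurable v P →
      (∀ᵐ ω ∂P, |u ω| ≤ C) → (∀ᵐ ω ∂P, |v ω| ≤ C) →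
      Integrable (fun ω => (u ω - v ω) ^ 2) P := by
    intro u v hu hv huC hvC
    refine Integrable.of_bound ((hu.sub hv).pow 2) ((C + C) ^ 2) ?_
    filter_upwards [huC, hvC] with ω h1 h2
    rw [norm_pow]
    gcongr
    exact (norm_sub_le _ _).trans (add_le_add h1 h2)
  have hcr : Integrable (fun ω => (ξ ω - η ω) * (η ω - g ω)) P := by
    refine Integrable.of_bound ((hξ.aestronglyMeasurable.sub hη).mul (hη.sub hgm))
      ((C + C) * (C + C)) ?_
    filter_upwards [hηC] with ω h1
    rw [norm_mul]
    gcongr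
    · exact (norm_sub_le _ _).trans (add_le_add (hξC ω) h1)
    · exact (norm_sub_le _ _).trans (add_le_add h1 (hgC ω))
  have i1 := hsqi hξ.aestronglyMeasurable hη (ae_of_all _ hξC) hηC
  have i2 := hsqi hη hgm hηC (ae_of_all _ hgC)
  have hexp : ∫ ω, (ξ ω - g ω) ^ 2 ∂P
      = ∫ ω, (ξ ω - η ω) ^ 2 ∂P + 2 * ∫ ω, (ξ ω - η ω) * (η ω - g ω) ∂P
        + ∫ ω, (η ω - g ω) ^ 2 ∂P := by
    rw [← integral_const_mul, ← integral_add i1 (hcr.const_mul 2)]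
    refine Eq.trans ?_ (integral_add (i1.add (hcr.const_mul 2)) i2)
    congr 1 with ω
    change _ = (ξ ω - η ω) ^ 2 + 2 * ((ξ ω - η ω) * (η ω - g ω)) + (η ω - g ω) ^ 2
    ring
  rw [hexp, hcross]
  have : 0 ≤ ∫ ω, (η ω - g ω) ^ 2 ∂P := integral_nonneg fun ω => sq_nonneg _
  linarith

/-! ### The time integral as a measurable functional on the product space of paths -/

section RightLimit

variable {E : Type*} [TopologicalSpace E] [Nonempty E]

/-- The point of the grid `{j / (k + 1)}` immediately to the right of `u ≥ 0`. -/
noncomputable def gridTime (k : ℕ) (u : ℝ) : ℝ≥0 :=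
  ((⌊((k : ℝ) + 1) * u⌋₊ + 1 : ℕ) : ℝ≥0) / ((k : ℝ≥0) + 1)

theorem lt_gridTime (k : ℕ) (u : ℝ) : u < gridTime k u := by
  have hk : (0 : ℝ) < (k : ℝ) + 1 := by positivity
  simp only [gridTime, NNReal.coe_div, NNReal.coe_natCast, NNReal.coe_add, NNReal.coe_one]
  rw [lt_div_iff₀ hk, mul_comm]
  push_cast
  exact Nat.lt_floor_add_one _

theorem gridTime_le (k : ℕ) {u : ℝ} (hu : 0 ≤ u) : gridTime k u ≤ u + 1 / ((k : ℝ) + 1) := by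
  have hk : (0 : ℝ) < (k : ℝ) + 1 := by positivity
  simp only [gridTime, NNReal.coe_div, NNReal.coe_natCast, NNReal.coe_add, NNReal.coe_one]
  rw [div_le_iff₀ hk, add_mul u, one_div_mul_cancel hk.ne']
  push_cast
  have := Nat.floor_le (mul_nonneg hk.le hu)
  linarith

theorem tendsto_gridTime {u : ℝ} (hu : 0 ≤ u) :
    Tendsto (fun k => (gridTime k u : ℝ)) atTop (𝓝 u) := by
  refine tendsto_of_tendsto_of_tendsto_of_le_of_le tendsto_const_nhds ?_
    (fun k => (lt_gridTime k u).le) (fun k => gridTime_le k hu)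
  simpa using tendsto_const_nhds.add (tendsto_one_div_add_atTop_nhds_zero_nat (𝕜 := ℝ))

/-- The right limit at `u` of the path `x`, taken along the grid points `gridTime k u`. It recovers
a right-continuous path, and, unlike evaluation at `u`, is jointly measurable in `(x, u)` for the
product sigma-field on the space of all paths. -/
noncomputable def rightLimit (x : ℝ≥0 → E) (u : ℝ) : E :=
  limUnder atTop fun k => x (gridTime k u)

theorem measurable_rightLimit [PolishSpace E] [MeasurableSpace E] [BorelSpace E] :
    Measurable fun p : (ℝ≥0 → E) × ℝ => rightLimit p.1 p.2 := by
  refine (StronglyMeasurable.limUnder fun k => Measurable.stronglyMeasurable ?_).measurable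
  have h1 : Measurable fun q : (ℝ≥0 → E) × ℕ =>
      q.1 (((q.2 + 1 : ℕ) : ℝ≥0) / ((k : ℝ≥0) + 1)) :=
    measurable_from_prod_countable_left fun j =>
      measurable_pi_apply (((j + 1 : ℕ) : ℝ≥0) / ((k : ℝ≥0) + 1))
  have h2 : Measurable fun p : (ℝ≥0 → E) × ℝ => (p.1, ⌊((k : ℝ) + 1) * p.2⌋₊) := by fun_prop
  exact h1.comp h2

theorem rightLimit_eq [T2Space E] {I : Set ℝ} {y : ℝ → E} {a : ℝ} (ha : Set.Ici a ⊆ I)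
    (hy : IsCadlagOn I y) {u : ℝ} (hu : 0 ≤ u) :
    rightLimit (fun s : ℝ≥0 => y (a + s)) u = y (a + u) := by
  have hmem : ∀ s : ℝ, 0 ≤ s → a + s ∈ I := fun s hs => ha (by simpa using hs)
  refine Tendsto.limUnder_eq ?_
  refine (hy (a + u) (hmem u hu)).1.tendsto.comp (tendsto_nhdsWithin_iff.2 ⟨?_, ?_⟩)
  · exact tendsto_const_nhds.add (tendsto_gridTime hu)
  · exact Eventually.of_forall fun k => ⟨hmem _ (by positivity), by
      simpa using (lt_gridTime k u).le⟩

variable {F : Type*} [NormedAddCommGroup F] [NormedSpace ℝ F]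

/-- The integral `∫_0^s h(x_u) du` as a functional of the path `x`, with `x` replaced by its
right limits so that it is measurable for the product sigma-field. -/
noncomputable def pathIntegral (h : E → F) (s : ℝ≥0) (x : ℝ≥0 → E) : F :=
  ∫ u in (0 : ℝ)..s, h (rightLimit x u)

theorem measurable_pathIntegral [PolishSpace E] [MeasurableSpace E] [BorelSpace E]
    [MeasurableSpace F] [BorelSpace F] [SecondCountableTopology F]
    {h : E → F} (hh : Measurable h) (s : ℝ≥0) : Measurable (pathIntegral h s) := by
  have : pathIntegral h s = fun x => ∫ u in Set.Ioc (0 : ℝ) s, h (rightLimit x u) := by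
    ext x
    exact intervalIntegral.integral_of_le s.2
  rw [this]
  exact (StronglyMeasurable.integral_prod_right
    (f := fun (x : ℝ≥0 → E) (u : ℝ) => h (rightLimit x u))
    (hh.comp measurable_rightLimit).stronglyMeasurable).measurable

theorem pathIntegral_eq [T2Space E] (h : E → F) {I : Set ℝ} {y : ℝ → E} {a : ℝ}
    (ha : Set.Ici a ⊆ I) (hy : IsCadlagOn I y) (s : ℝ≥0) :
    pathIntegral h s (fun u : ℝ≥0 => y (a + u)) = ∫ u in a..(a + s), h (y u) := by
  have h1 := intervalIntegral.integral_comp_add_left (a := 0) (b := (s : ℝ)) (fun u => h (y u)) a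
  rw [add_zero] at h1
  rw [← h1]
  refine intervalIntegral.integral_congr fun u hu => ?_
  rw [Set.uIcc_of_le s.coe_nonneg] at hu
  exact congrArg h (rightLimit_eq ha hy hu.1)

end RightLimit

/-! ### Laws of the future of a Markov process -/

theorem processSigma_le {Ω G : Type*} [MeasurableSpace Ω] [MeasurableSpace G] {Z : ℝ → Ω → G}
    {J : Set ℝ}
    (hZ : ∀ s ∈ J, Measurable (Z s)) : processSigma Z J ≤ ‹MeasurableSpace Ω› :=
  iSup₂_le fun s hs => (hZ s hs).comap_le

theorem measurable_processSigma {Ω G : Type*} [MeasurableSpace G] {Z : ℝ → Ω → G} {J : Set ℝ}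
    {s : ℝ} (hs : s ∈ J) : Measurable[processSigma Z J] (Z s) :=
  measurable_iff_comap_le.2 (le_iSup₂_of_le s hs le_rfl)

section Markov

variable {E : Type*} [MeasurableSpace E]

theorem measurable_extend (k : ℕ) :
    Measurable fun (p : (ℕ → E) × E) (i : ℕ) => if i ≤ k then p.1 i else p.2 := by
  refine measurable_pi_lambda _ fun i => ?_
  by_cases hi : i ≤ k
  · simpa only [hi, if_true] using! (measurable_pi_apply i).comp measurable_fst
  · simpa only [hi, if_false] using measurable_snd

/-- The kernel that keeps a path `y : ℕ → E` up to index `k`, draws a point from `L (y k)`, and makes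
this point the value at all later indices. -/
noncomputable def extendKernel (L : Kernel E E) (k : ℕ) : Kernel (ℕ → E) (ℕ → E) :=
  (Kernel.id ×ₖ L.comap (fun y : ℕ → E => y k) (measurable_pi_apply k)).map
    fun p i => if i ≤ k then p.1 i else p.2

/-- The law of a Markov chain which starts from a given point at time `τ 0`, moves at the times `τ 1`,
`τ 2`, … according to the transition probabilities `K`, and is stopped after `k` steps. All chains
live on `ℕ → E`, being constant from index `k` on, so that the target does not depend on `k`. -/
noncomputable def chainKernel (K : ℝ≥0 → Kernel E E) (τ : ℕ → ℝ≥0) : ℕ → Kernel E (ℕ → E)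
  | 0 => Kernel.deterministic (fun x _ => x) (measurable_pi_lambda _ fun _ => measurable_id)
  | k + 1 => extendKernel (K (τ (k + 1) - τ k)) k ∘ₖ chainKernel K τ k

instance (L : Kernel E E) [IsMarkovKernel L] (k : ℕ) : IsMarkovKernel (extendKernel L k) := by
  unfold extendKernel
  exact Kernel.IsMarkovKernel.map _ (measurable_extend k)

instance (K : ℝ≥0 → Kernel E E) [∀ t, IsMarkovKernel (K t)] (τ : ℕ → ℝ≥0) (k : ℕ) :
    IsMarkovKernel (chainKernel K τ k) := by
  induction k with
  | zero => unfold chainKernel; infer_instance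
  | succ k ih => unfold chainKernel; infer_instance

variable {Ω : Type*} [MeasurableSpace Ω] {I : Set ℝ} {K : ℝ≥0 → Kernel E E}
  [∀ t, IsMarkovKernel (K t)] {X : ℝ → Ω → E} {P : Measure Ω} [IsProbabilityMeasure P]

/-- The Markov property at time `s` as a disintegration: given a variable `Z` that depends on the past
up to `s` and determines `X s`, the variable `X (s + d)` has conditional law `K d (X s)`. -/
theorem IsMarkovProcess.map_prod_eq_compProd (hX : ∀ t ∈ I, Measurable (X t))
    (hM : IsMarkovProcess I K X P) {s : ℝ} (hs : s ∈ I) {d : ℝ≥0} (hd : s + (d : ℝ) ∈ I)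
    {S : Type*} [MeasurableSpace S] {Z : Ω → S}
    (hZ : Measurable[processSigma X (I ∩ Set.Iic s)] Z) {φ : S → E} (hφ : Measurable φ)
    (hφZ : ∀ ω, φ (Z ω) = X s ω) :
    P.map (fun ω => (Z ω, X (s + d) ω)) = P.map Z ⊗ₘ (K d).comap φ hφ := by
  have hle : processSigma X (I ∩ Set.Iic s) ≤ ‹MeasurableSpace Ω› :=
    processSigma_le fun r hr => hX r hr.1
  have hZ' : Measurable Z := hZ.mono hle le_rfl
  have hZp := Measure.isProbabilityMeasure_map (μ := P) hZ'.aemeasurable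
  have hpair : Measurable fun ω => (Z ω, X (s + d) ω) := hZ'.prodMk (hX _ hd)
  have hpp := Measure.isProbabilityMeasure_map (μ := P) hpair.aemeasurable
  refine Measure.ext_prod fun {A D} hA hD => ?_
  rw [Measure.compProd_apply_prod hA hD, Measure.map_apply hpair (hA.prod hD),
    setLIntegral_map hA (Kernel.measurable_coe _ hD) hZ']
  have hF : MeasurableSet[processSigma X (I ∩ Set.Iic s)] (Z ⁻¹' A) := hZ hA
  have hD' : MeasurableSet (X (s + d) ⁻¹' D) := hX _ hd hD
  have hcond := setIntegral_condExp hle (μ := P)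
    (f := (X (s + d) ⁻¹' D).indicator fun _ => (1 : ℝ))
    ((integrable_const 1).indicator hD') hF
  rw [setIntegral_congr_ae (hle _ hF) ((hM s hs d hd D hD).mono fun ω h _ => h),
    setIntegral_indicator hD', setIntegral_const] at hcond
  have hset : (fun ω => (Z ω, X (s + d) ω)) ⁻¹' A ×ˢ D = Z ⁻¹' A ∩ X (s + d) ⁻¹' D := rfl
  have hmeas : Measurable fun ω => K d (X s ω) D := (Kernel.measurable_coe _ hD).comp (hX s hs)
  rw [hset, ← ENNReal.toReal_eq_toReal_iff' (by finiteness) ?_]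
  · simp only [smul_eq_mul, mul_one] at hcond
    rw [← Measure.real, ← hcond]
    simp only [Kernel.comap_apply, hφZ]
    exact integral_toReal hmeas.aemeasurable (ae_of_all _ fun ω => measure_lt_top _ _)
  · refine ne_top_of_le_ne_top (b := P (Z ⁻¹' A)) (by finiteness) ?_
    calc _ ≤ ∫⁻ ω in Z ⁻¹' A, 1 ∂P := lintegral_mono fun ω => prob_le_one
      _ = _ := by simp

/-- The finite-dimensional distributions of a Markov process after time `a` are the images of the law
of `X a` under kernels which depend on the transition probabilities only. -/
theorem IsMarkovProcess.map_chain_eq (hX : ∀ t ∈ I, Measurable (X t))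
    (hM : IsMarkovProcess I K X P) {a : ℝ} (ha : Set.Ici a ⊆ I) {τ : ℕ → ℝ≥0} (hτ : Monotone τ)
    (hτ0 : τ 0 = 0) (k : ℕ) :
    P.map (fun ω i => X (a + τ (min i k)) ω) = (P.map (X a)).bind (chainKernel K τ k) := by
  have hmem : ∀ s : ℝ≥0, a + (s : ℝ) ∈ I := fun s => ha (by simp)
  have hXa : Measurable (X a) := hX a (ha (by simp))
  induction k with
  | zero =>
    rw [chainKernel, Measure.deterministic_comp_eq_map, Measure.map_map _ hXa]
    · simp [hτ0, Function.comp_def]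
    · exact measurable_pi_lambda _ fun _ => measurable_id
  | succ k ih =>
    have hZ : Measurable[processSigma X (I ∩ Set.Iic (a + τ k))]
        fun ω (i : ℕ) => X (a + τ (min i k)) ω :=
      @measurable_pi_lambda Ω ℕ (fun _ => E) (processSigma X (I ∩ Set.Iic (a + τ k))) _ _
        fun i => measurable_processSigma ⟨hmem _, by simpa using hτ (min_le_right i k)⟩
    have hstep : ((τ (k + 1) - τ k : ℝ≥0) : ℝ) = τ (k + 1) - τ k :=
      NNReal.coe_sub (hτ k.le_succ)
    have hnext : a + (τ k : ℝ) + ((τ (k + 1) - τ k : ℝ≥0) : ℝ) = a + τ (k + 1) := by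
      rw [hstep]; ring
    have hprod := hM.map_prod_eq_compProd hX (hmem (τ k)) (d := τ (k + 1) - τ k)
      (by rw [hnext]; exact hmem _) hZ (measurable_pi_apply k) (fun ω => by simp)
    rw [hnext] at hprod
    rw [chainKernel, ← Measure.comp_assoc, ← ih, extendKernel,
      ← Measure.map_comp _ _ (measurable_extend k), ← Measure.compProd_eq_comp_prod, ← hprod,
      Measure.map_map (measurable_extend k)]
    · congr 1
      ext ω i
      by_cases hi : i ≤ k
      · simp [hi, hi.trans k.le_succ]
      · simp [hi, show k + 1 ≤ i by omega]
    · exact Measurable.prodMk (measurable_pi_lambda _ fun i => hX _ (hmem _)) (hX _ (hmem _))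

/-- For two Markov processes with the same transition probabilities, the laws of the paths after
given times are at most as far apart as the laws at these times. -/
theorem map_path_le_add {Ω' : Type*} [MeasurableSpace Ω'] {I' : Set ℝ} {X' : ℝ → Ω' → E}
    {P' : Measure Ω'} [IsProbabilityMeasure P']
    (hX : ∀ t ∈ I, Measurable (X t)) (hM : IsMarkovProcess I K X P)
    (hX' : ∀ t ∈ I', Measurable (X' t)) (hM' : IsMarkovProcess I' K X' P')
    {a a' : ℝ} (ha : Set.Ici a ⊆ I) (ha' : Set.Ici a' ⊆ I') {σ : Measure E}
    (hσ : P.map (X a) ≤ P'.map (X' a') + σ) {A : Set (ℝ≥0 → E)} (hA : MeasurableSet A) :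
    P.map (fun ω (s : ℝ≥0) => X (a + s) ω) A
      ≤ P'.map (fun ω (s : ℝ≥0) => X' (a' + s) ω) A + σ Set.univ := by
  have hm : Measurable fun ω (s : ℝ≥0) => X (a + s) ω :=
    measurable_pi_lambda _ fun s => hX _ (ha (by simp))
  have hm' : Measurable fun ω (s : ℝ≥0) => X' (a' + s) ω :=
    measurable_pi_lambda _ fun s => hX' _ (ha' (by simp))
  have hp := Measure.isProbabilityMeasure_map (μ := P) hm.aemeasurable
  have hp' := Measure.isProbabilityMeasure_map (μ := P') hm'.aemeasurable
  refine measure_le_add_of_le_add_cylinder _ _ _ (fun J C hC => ?_) hA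
  obtain ⟨τ, N, idx, hτ, hτ0, hidx⟩ := exists_monotone_enumeration J
  have hρ : Measurable fun (y : ℕ → E) (j : J) => y (idx j) :=
    measurable_pi_lambda _ fun j => measurable_pi_apply _
  have hC' := hρ hC
  have hfdd : J.restrict ∘ (fun ω (s : ℝ≥0) => X (a + s) ω)
      = (fun (y : ℕ → E) (j : J) => y (idx j)) ∘ fun ω i => X (a + τ (min i N)) ω := by
    ext ω j
    simp [(hidx j).1, (hidx j).2]
  have hfdd' : J.restrict ∘ (fun ω (s : ℝ≥0) => X' (a' + s) ω)
      = (fun (y : ℕ → E) (j : J) => y (idx j)) ∘ fun ω i => X' (a' + τ (min i N)) ω := by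
    ext ω j
    simp [(hidx j).1, (hidx j).2]
  rw [Measure.map_map (Finset.measurable_restrict J) hm,
    Measure.map_map (Finset.measurable_restrict J) hm', hfdd, hfdd',
    ← Measure.map_map hρ (measurable_pi_lambda _ fun i => hX _ (ha (by simp))),
    ← Measure.map_map hρ (measurable_pi_lambda _ fun i => hX' _ (ha' (by simp))),
    hM.map_chain_eq hX ha hτ hτ0, hM'.map_chain_eq hX' ha' hτ hτ0,
    Measure.map_apply hρ hC, Measure.map_apply hρ hC,
    Measure.bind_apply hC' (Kernel.aemeasurable _), Measure.bind_apply hC' (Kernel.aemeasurable _)]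
  calc _ ≤ ∫⁻ x, chainKernel K τ N x ((fun y (j : J) => y (idx j)) ⁻¹' C)
          ∂(P'.map (X' a') + σ) := lintegral_mono' hσ le_rfl
    _ ≤ _ := by
      rw [lintegral_add_measure]
      gcongr
      calc _ ≤ ∫⁻ _, 1 ∂σ := lintegral_mono fun x => prob_le_one
        _ = _ := by simp

end Markov

/-! ### The law of the increments of a Wiener process -/

section Wiener

variable {n : ℕ} {Ω : Type*} [MeasurableSpace Ω] {I : Set ℝ}
  {B : ℝ → Ω → EuclideanSpace ℝ (Fin n)} {P : Measure Ω}

theorem IsWienerProcess.map_consecutive_increments (hB : IsWienerProcess I B P) {a : ℝ}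
    (ha : Set.Ici a ⊆ I) {τ : ℕ → ℝ≥0} (hτ : Monotone τ) (N : ℕ) :
    P.map (fun ω (i : Fin N) => B (a + τ (i + 1)) ω - B (a + τ i) ω)
      = Measure.pi fun i : Fin N =>
        multivariateGaussian 0
          (((τ (i + 1) : ℝ) - τ i) • (1 : Matrix (Fin n) (Fin n) ℝ)) := by
  have hmem : ∀ s : ℝ≥0, a + (s : ℝ) ∈ I := fun s => ha (by simp)
  have hmono : Monotone fun i => (⟨a + τ i, hmem _⟩ : I) := fun i j hij => by
    simpa using hτ hij
  have hind := (hB.indep_increments.nat hmono).precomp (g := fun i : Fin N => (i : ℕ))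
    Fin.val_injective
  refine (hind.map_fun_eq_pi_map fun i =>
    ((hB.measurable _ (hmem _)).sub (hB.measurable _ (hmem _))).aemeasurable).trans ?_
  congr 1 with i : 1
  have := (hB.law_increments _ (hmem (τ i)) _ (hmem (τ (i + 1)))
    (by simpa using hτ (Nat.le_succ _))).map_eq
  rwa [add_sub_add_left_eq_sub] at this

/-- The law of the increments of a Wiener process from a given time does not depend on that time,
nor on the Wiener process. -/
theorem IsWienerProcess.map_increments_eq {Ω' : Type*} [MeasurableSpace Ω'] {I' : Set ℝ}
    {B' : ℝ → Ω' → EuclideanSpace ℝ (Fin n)} {P' : Measure Ω'} [IsProbabilityMeasure P]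
    [IsProbabilityMeasure P']
    (hB : IsWienerProcess I B P) (hB' : IsWienerProcess I' B' P') {a a' : ℝ}
    (ha : Set.Ici a ⊆ I) (ha' : Set.Ici a' ⊆ I') :
    P.map (fun ω (s : ℝ≥0) => B (a + s) ω - B a ω)
      = P'.map (fun ω (s : ℝ≥0) => B' (a' + s) ω - B' a' ω) := by
  have hm : ∀ s : ℝ≥0, Measurable fun ω => B (a + s) ω - B a ω := fun s =>
    (hB.measurable _ (ha (by simp))).sub (hB.measurable _ (ha (by simp)))
  have hm' : ∀ s : ℝ≥0, Measurable fun ω => B' (a' + s) ω - B' a' ω := fun s =>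
    (hB'.measurable _ (ha' (by simp))).sub (hB'.measurable _ (ha' (by simp)))
  have hlim := isProjectiveLimit_map (P := P) (X := fun (s : ℝ≥0) ω => B (a + s) ω - B a ω)
    (measurable_pi_lambda _ hm).aemeasurable
  have hlim' := isProjectiveLimit_map (P := P')
    (X := fun (s : ℝ≥0) ω => B' (a' + s) ω - B' a' ω)
    (measurable_pi_lambda _ hm').aemeasurable
  refine hlim.unique (fun J => ?_)
  rw [hlim' J]
  obtain ⟨τ, N, idx, hτ, hτ0, hidx⟩ := exists_monotone_enumeration J
  -- the values at the times in `J` are partial sums of the consecutive increments along `τ`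
  let S : (Fin N → EuclideanSpace ℝ (Fin n)) → (J → EuclideanSpace ℝ (Fin n)) :=
    fun z j => ∑ i : Fin N, if (i : ℕ) < idx j then z i else 0
  have hS : Measurable S := by
    refine measurable_pi_lambda _ fun j => Finset.measurable_sum _ fun i _ => ?_
    split_ifs
    · exact measurable_pi_apply i
    · exact measurable_const
  have hsum : ∀ (b : ℝ → EuclideanSpace ℝ (Fin n)) (c : ℝ) (j : J),
      S (fun i => b (c + τ (i + 1)) - b (c + τ i)) j = b (c + (j : ℝ≥0)) - b c := by
    intro b c j
    have h1 := Finset.sum_range (n := N)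
      fun i => if i < idx j then b (c + τ (i + 1)) - b (c + τ i) else 0
    refine h1.symm.trans ?_
    rw [← Finset.sum_filter]
    have h2 : (Finset.range N).filter (fun i => i < idx j) = Finset.range (idx j) := by
      ext i
      have := (hidx j).1
      simp only [Finset.mem_filter, Finset.mem_range]
      omega
    rw [h2, Finset.sum_range_sub (fun i => b (c + τ i)), (hidx j).2, hτ0]
    simp
  have hfdd : (fun ω => J.restrict fun s : ℝ≥0 => B (a + s) ω - B a ω)
      = S ∘ fun ω (i : Fin N) => B (a + τ (i + 1)) ω - B (a + τ i) ω := by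
    ext1 ω
    ext1 j
    exact (hsum (fun t => B t ω) a j).symm
  have hfdd' : (fun ω => J.restrict fun s : ℝ≥0 => B' (a' + s) ω - B' a' ω)
      = S ∘ fun ω (i : Fin N) => B' (a' + τ (i + 1)) ω - B' (a' + τ i) ω := by
    ext1 ω
    ext1 j
    exact (hsum (fun t => B' t ω) a' j).symm
  beta_reduce
  rw [hfdd, hfdd', ← Measure.map_map hS, ← Measure.map_map hS,
    hB.map_consecutive_increments ha hτ, hB'.map_consecutive_increments ha' hτ]
  · exact measurable_pi_lambda _ fun i =>
      (hB.measurable _ (ha (by simp))).sub (hB.measurable _ (ha (by simp)))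
  · exact measurable_pi_lambda _ fun i =>
      (hB'.measurable _ (ha' (by simp))).sub (hB'.measurable _ (ha' (by simp)))

end Wiener

/-! ### Windows of observations and the filtering error -/

section Window

variable {n : ℕ} {Ω : Type*}

/-- The increments over the window `[a, a + r]` of the process `Y` from its value at time `a`,
as a path on `[0, ∞)` which is stopped at time `r`. -/
def windowIncrements (Y : ℝ → Ω → EuclideanSpace ℝ (Fin n)) (a : ℝ) (r : ℝ≥0) (ω : Ω) (s : ℝ≥0) :
    EuclideanSpace ℝ (Fin n) :=
  Y (a + (min s r : ℝ≥0)) ω - Y a ω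

theorem obsSigma_eq_comap_windowIncrements (Y : ℝ → Ω → EuclideanSpace ℝ (Fin n)) (a : ℝ)
    (r : ℝ≥0) :
    obsSigma Y a (a + r) = MeasurableSpace.comap (windowIncrements Y a r) inferInstance := by
  refine le_antisymm (iSup₂_le fun s hs => ?_) ?_
  · obtain ⟨u, rfl⟩ : ∃ u : ℝ≥0, s = a + u := 
      ⟨⟨s - a, sub_nonneg.2 hs.1⟩, (add_sub_cancel a s).symm⟩
    have hu : u ≤ r := by simpa using hs.2
    have : (fun ω => Y (a + u) ω - Y a ω) = (fun y => y u) ∘ windowIncrements Y a r := by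
      ext1 ω
      simp [windowIncrements, min_eq_left hu]
    beta_reduce
    rw [this, ← MeasurableSpace.comap_comp]
    exact MeasurableSpace.comap_mono (measurable_pi_apply u).comap_le
  · refine Measurable.comap_le (m₁ := obsSigma Y a (a + r)) ?_
    refine @measurable_pi_lambda Ω ℝ≥0 (fun _ => EuclideanSpace ℝ (Fin n))
      (obsSigma Y a (a + r)) _ _ fun s => ?_
    exact measurable_processSigma (Z := fun t ω => Y t ω - Y a ω)
      ⟨by simp, by simp⟩

theorem obsSigma_mono (Y : ℝ → Ω → EuclideanSpace ℝ (Fin n)) {a b c d : ℝ} (hca : c ≤ a)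
    (hbd : b ≤ d) : obsSigma Y a b ≤ obsSigma Y c d := by
  refine iSup₂_le fun s hs => Measurable.comap_le (m₁ := obsSigma Y c d) ?_
  have h1 : Measurable[obsSigma Y c d] fun ω => Y s ω - Y c ω :=
    measurable_processSigma (Z := fun t ω => Y t ω - Y c ω) ⟨hca.trans hs.1, hs.2.trans hbd⟩
  have h2 : Measurable[obsSigma Y c d] fun ω => Y a ω - Y c ω :=
    measurable_processSigma (Z := fun t ω => Y t ω - Y c ω) ⟨hca, hs.1.trans (hs.2.trans hbd)⟩
  convert h1.sub h2 using 1
  ext1 ω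
  simp

theorem obsSigma_le [MeasurableSpace Ω] {Y : ℝ → Ω → EuclideanSpace ℝ (Fin n)} {I : Set ℝ}
    (hI : IsUpperSet I) (hY : ∀ t ∈ I, Measurable (Y t)) {a b : ℝ} (ha : a ∈ I) :
    obsSigma Y a b ≤ ‹MeasurableSpace Ω› :=
  processSigma_le fun _ hs => (hY _ (hI hs.1 ha)).sub (hY _ ha)

/-- The observation sigma-field of the infinite past is generated by an increasing sequence. -/
theorem iSup_obsSigma_neg_natCast (Y : ℝ → Ω → EuclideanSpace ℝ (Fin n)) :
    ⨆ k : ℕ, obsSigma Y (-(k : ℝ)) 0 = obsSigmaPast Y 0 := by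
  refine le_antisymm (iSup_le fun k => ?_) (iSup₂_le fun a _ => ?_)
  · have hk : -((k : ℝ) + 1) < 0 := neg_lt_zero.2 (by positivity)
    exact (obsSigma_mono Y (by linarith) le_rfl).trans
      (le_iSup₂_of_le (-((k : ℝ) + 1)) hk le_rfl)
  · obtain ⟨k, hk⟩ := exists_nat_ge (-a)
    exact le_iSup_of_le k (obsSigma_mono Y (by linarith) le_rfl)

end Window

section Model

variable {E : Type*} [TopologicalSpace E] [MeasurableSpace E] {n : ℕ}
  {K : ℝ≥0 → Kernel E E} {h : E → EuclideanSpace ℝ (Fin n)}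
  {Ω : Type*} [MeasurableSpace Ω] {I : Set ℝ} {X : ℝ → Ω → E}
  {B : ℝ → Ω → EuclideanSpace ℝ (Fin n)} {P : Measure Ω}

/-- The path of the signal after time `a`, together with the noise increments from time `a`. -/
def futurePaths (X : ℝ → Ω → E) (B : ℝ → Ω → EuclideanSpace ℝ (Fin n)) (a : ℝ) (ω : Ω) :
    (ℝ≥0 → E) × (ℝ≥0 → EuclideanSpace ℝ (Fin n)) :=
  (fun s => X (a + s) ω, fun s => B (a + s) ω - B a ω)

theorem IsFilteringModel.measurable_futurePaths (hM : IsFilteringModel I K h X B P)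
    (hI : IsUpperSet I) {a : ℝ} (ha : a ∈ I) : Measurable (futurePaths X B a) :=
  (measurable_pi_lambda _ fun s => hM.measurable_signal _ (hI (by simp) ha)).prodMk
    (measurable_pi_lambda _ fun s =>
      (hM.wiener.measurable _ (hI (by simp) ha)).sub (hM.wiener.measurable _ ha))

theorem IsFilteringModel.map_futurePaths [IsProbabilityMeasure P]
    (hM : IsFilteringModel I K h X B P) (hI : IsUpperSet I) {a : ℝ} (ha : a ∈ I) :
    P.map (futurePaths X B a) = (P.map fun ω (s : ℝ≥0) => X (a + s) ω).prod
      (P.map fun ω (s : ℝ≥0) => B (a + s) ω - B a ω) := by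
  have hmem : ∀ s : ℝ≥0, a + (s : ℝ) ∈ I := fun s => hI (by simp) ha
  have hm := hM.measurable_futurePaths hI ha
  have hind := hM.indep.comp
    (φ := fun (x : I → E) (s : ℝ≥0) => x ⟨a + s, hmem s⟩)
    (ψ := fun (b : I → EuclideanSpace ℝ (Fin n)) (s : ℝ≥0) => b ⟨a + s, hmem s⟩ - b ⟨a, ha⟩)
    (measurable_pi_lambda _ fun s => measurable_pi_apply _)
    (measurable_pi_lambda _ fun s => (measurable_pi_apply _).sub (measurable_pi_apply _))
  exact (indepFun_iff_map_prod_eq_prod_map_map hm.fst.aemeasurable hm.snd.aemeasurable).1 hind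

/-- The observation increments over a window of length `r`, as a functional of the paths of the
signal and of the noise increments after the start of the window. -/
noncomputable def observedPath [Nonempty E] (h : E → EuclideanSpace ℝ (Fin n)) (κ : ℝ) (r : ℝ≥0)
    (p : (ℝ≥0 → E) × (ℝ≥0 → EuclideanSpace ℝ (Fin n))) (s : ℝ≥0) : EuclideanSpace ℝ (Fin n) :=
  pathIntegral h (min s r) p.1 + κ • p.2 (min s r)

/-- The equality holds almost surely only: it splits an integral of `h(X_u)`, hence needs the
integrability of this function. -/
theorem IsFilteringModel.windowIncrements_ae_eq [T2Space E] [Nonempty E]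
    (hM : IsFilteringModel I K h X B P)
    (hI : IsUpperSet I) (h0 : (0 : ℝ) ∈ I) (κ : ℝ) {a : ℝ} (ha : a ∈ I) (r : ℝ≥0) :
    ∀ᵐ ω ∂P, windowIncrements (observation h X B κ) a r ω
      = observedPath h κ r (futurePaths X B a ω) := by
  filter_upwards [hM.integrable] with ω hω
  ext1 s
  have hs : a + (min s r : ℝ≥0) ∈ I := hI (by simp) ha
  simp only [windowIncrements, observation, observedPath, futurePaths]
  rw [pathIntegral_eq h (hI.Ici_subset ha) (hM.cadlag ω),
    ← intervalIntegral.integral_interval_sub_left (hω 0 h0 _ hs) (hω 0 h0 _ ha), smul_sub]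
  abel

variable [PolishSpace E] [BorelSpace E]

/-- The observations are random variables although `h` is merely measurable: the integral is a
measurable functional of the path from time `min 0 t` on. -/
theorem IsFilteringModel.measurable_observation [Nonempty E]
    (hM : IsFilteringModel I K h X B P) (hI : IsUpperSet I) (h0 : (0 : ℝ) ∈ I) (hh : Measurable h)
    (κ : ℝ) {t : ℝ} (ht : t ∈ I) : Measurable (observation h X B κ t) := by
  have hint : ∀ a ∈ I, ∀ s : ℝ≥0, Measurable fun ω => ∫ u in a..(a + s), h (X u ω) := by
    intro a ha s
    have hpath : Measurable fun ω (u : ℝ≥0) => X (a + u) ω :=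
      measurable_pi_lambda _ fun u => hM.measurable_signal _ (hI (by simp) ha)
    have := (measurable_pathIntegral hh s).comp hpath
    simp only [Function.comp_def] at this
    convert this using 2 with ω
    exact (pathIntegral_eq h (hI.Ici_subset ha) (hM.cadlag ω) s).symm
  refine Measurable.add ?_ ((hM.wiener.measurable t ht).const_smul κ)
  rcases le_total 0 t with h | h
  · simpa using! hint 0 h0 ⟨t, h⟩
  · have := (hint t ht (-t).toNNReal).neg
    rw [Real.coe_toNNReal _ (neg_nonneg.2 h), add_neg_cancel] at this
    convert this using 2 with ω
    exact intervalIntegral.integral_symm _ _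

theorem measurable_observedPath [Nonempty E] (hh : Measurable h) (κ : ℝ) (r : ℝ≥0) :
    Measurable (observedPath h κ r) :=
  measurable_pi_lambda _ fun _ => ((measurable_pathIntegral hh _).comp measurable_fst).add
    (((measurable_pi_apply _).comp measurable_snd).const_smul κ)

theorem IsFilteringModel.integral_sq_window [Nonempty E]
    (hM : IsFilteringModel I K h X B P) (hI : IsUpperSet I) (h0 : (0 : ℝ) ∈ I) (hh : Measurable h)
    (κ : ℝ) {a : ℝ} (ha : a ∈ I) (r : ℝ≥0) {f : E → ℝ} (hf : Measurable f)
    {g : (ℝ≥0 → EuclideanSpace ℝ (Fin n)) → ℝ} (hg : Measurable g) :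
    ∫ ω, (f (X (a + r) ω) - g (windowIncrements (observation h X B κ) a r ω)) ^ 2 ∂P
      = ∫ p, (f (p.1 r) - g (observedPath h κ r p)) ^ 2 ∂(P.map (futurePaths X B a)) := by
  have hΨ : Measurable fun p : (ℝ≥0 → E) × (ℝ≥0 → EuclideanSpace ℝ (Fin n)) =>
      (f (p.1 r) - g (observedPath h κ r p)) ^ 2 :=
    ((hf.comp ((measurable_pi_apply r).comp measurable_fst)).sub
      (hg.comp (measurable_observedPath hh κ r))).pow_const 2
  rw [integral_map (hM.measurable_futurePaths hI ha).aemeasurable hΨ.aestronglyMeasurable]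
  refine integral_congr_ae ?_
  filter_upwards [hM.windowIncrements_ae_eq hI h0 κ ha r] with ω hω
  rw [hω]
  rfl

/-- If the law of `X a` is at most that of `X' a'` plus an error measure `σ`, then estimating
`f (X (a + r))` from the observations on a time interval `[c, a + r]` that contains `[a, a + r]` is
at most as hard as estimating `f (X' (a' + r))` from those on `[a', a' + r]`, up to a multiple of the
total mass of `σ`. -/
theorem IsFilteringModel.integral_sq_sub_condExp_le_add [∀ t, IsMarkovKernel (K t)]
    [IsProbabilityMeasure P] (hM : IsFilteringModel I K h X B P) (hI : IsUpperSet I)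
    (h0 : (0 : ℝ) ∈ I)
    {Ω' : Type*} [MeasurableSpace Ω'] {I' : Set ℝ} {X' : ℝ → Ω' → E}
    {B' : ℝ → Ω' → EuclideanSpace ℝ (Fin n)} {P' : Measure Ω'} [IsProbabilityMeasure P']
    (hM' : IsFilteringModel I' K h X' B' P') (hI' : IsUpperSet I') (h0' : (0 : ℝ) ∈ I')
    (hh : Measurable h) (κ : ℝ) {a a' : ℝ} (ha : a ∈ I) (ha' : a' ∈ I') (r : ℝ≥0)
    {σ : Measure E} [IsFiniteMeasure σ] (hσ : P.map (X a) ≤ P'.map (X' a') + σ)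
    {f : E → ℝ} (hf : Measurable f) {C : ℝ} (hC : ∀ x, |f x| ≤ C)
    {c : ℝ} (hc : c ∈ I) (hca : c ≤ a) :
    ∫ ω, (f (X (a + r) ω) - (P[fun ω' => f (X (a + r) ω') |
        obsSigma (observation h X B κ) c (a + r)]) ω) ^ 2 ∂P
      ≤ ∫ ω, (f (X' (a' + r) ω) - (P'[fun ω' => f (X' (a' + r) ω') |
          obsSigma (observation h X' B' κ) a' (a' + r)]) ω) ^ 2 ∂P'
        + (C + C) ^ 2 * σ.real Set.univ := by
  obtain ⟨ω₀⟩ := nonempty_of_isProbabilityMeasure P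
  have : Nonempty E := ⟨X a ω₀⟩
  have hC0 : 0 ≤ C := (abs_nonneg _).trans (hC (X a ω₀))
  -- the conditional expectation in the second model is a measurable functional of the increments
  obtain ⟨g₀, hg₀, hg₀eq⟩ : ∃ g₀ : (ℝ≥0 → EuclideanSpace ℝ (Fin n)) → ℝ, Measurable g₀ ∧
      P'[fun ω' => f (X' (a' + r) ω') | obsSigma (observation h X' B' κ) a' (a' + r)]
        = g₀ ∘ windowIncrements (observation h X' B' κ) a' r := by
    refine Measurable.exists_eq_measurable_comp ?_
    rw [obsSigma_eq_comap_windowIncrements]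
    exact stronglyMeasurable_condExp.measurable
  -- it takes values in `[-C, C]` almost surely, so it may be truncated
  let g : (ℝ≥0 → EuclideanSpace ℝ (Fin n)) → ℝ := fun y => max (-C) (min C (g₀ y))
  have hg : Measurable g := measurable_const.max (measurable_const.min hg₀)
  have hgC : ∀ y, |g y| ≤ C := fun y =>
    abs_le.2 ⟨le_max_left _ _, max_le (by linarith) (min_le_left _ _)⟩
  have hX : Measurable fun ω => f (X (a + r) ω) :=
    hf.comp (hM.measurable_signal _ (hI (by simp) ha))
  have hm : obsSigma (observation h X B κ) c (a + r) ≤ ‹MeasurableSpace Ω› :=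
    obsSigma_le hI (fun t ht => hM.measurable_observation hI h0 hh κ ht) hc
  have hgm : Measurable[obsSigma (observation h X B κ) c (a + r)]
      fun ω => g (windowIncrements (observation h X B κ) a r ω) := by
    have : Measurable[obsSigma (observation h X B κ) a (a + r)]
        (windowIncrements (observation h X B κ) a r) := by
      rw [obsSigma_eq_comap_windowIncrements]
      exact comap_measurable _
    exact hg.comp (this.mono (obsSigma_mono _ hca le_rfl) le_rfl)
  have hgeq : ∫ ω, (f (X' (a' + r) ω) - (P'[fun ω' => f (X' (a' + r) ω') |
          obsSigma (observation h X' B' κ) a' (a' + r)]) ω) ^ 2 ∂P'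
      = ∫ ω, (f (X' (a' + r) ω)
          - g (windowIncrements (observation h X' B' κ) a' r ω)) ^ 2 ∂P' := by
    have hbd : ∀ᵐ ω ∂P', |(P'[fun ω' => f (X' (a' + r) ω') |
        obsSigma (observation h X' B' κ) a' (a' + r)]) ω| ≤ C :=
      ae_bdd_abs_condExp_of_ae_bdd_abs (ae_of_all _ fun ω => hC _)
    refine integral_congr_ae ?_
    filter_upwards [hbd] with ω hω
    rw [hg₀eq] at hω ⊢
    have h1 := abs_le.1 hω
    simp only [Function.comp_apply] at h1 ⊢
    simp only [g]
    rw [min_eq_right h1.2, max_eq_right h1.1]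
  rw [hgeq, hM'.integral_sq_window hI' h0' hh κ ha' r hf hg]
  refine (integral_sq_sub_condExp_le hm P hX hgm (fun ω => hC _) (fun ω => hgC _)).trans ?_
  rw [hM.integral_sq_window hI h0 hh κ ha r hf hg]
  have hmF := hM.measurable_futurePaths hI ha
  have hmF' := hM'.measurable_futurePaths hI' ha'
  have := Measure.isProbabilityMeasure_map (μ := P) hmF.aemeasurable
  have := Measure.isProbabilityMeasure_map (μ := P') hmF'.aemeasurable
  have : IsProbabilityMeasure (P'.map fun ω (s : ℝ≥0) => B' (a' + s) ω - B' a' ω) :=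
    Measure.isProbabilityMeasure_map hmF'.snd.aemeasurable
  refine integral_le_add_of_measure_le_add _ _ (fun A hA => ?_) measureReal_nonneg ?_
    (fun p => sq_nonneg _) (fun p => ?_)
  · rw [ofReal_measureReal, hM.map_futurePaths hI ha, hM'.map_futurePaths hI' ha',
      hM.wiener.map_increments_eq hM'.wiener (hI.Ici_subset ha) (hI'.Ici_subset ha')]
    exact prod_le_add_of_le_add _ _ _ _ (fun A hA => map_path_le_add hM.measurable_signal hM.markov
      hM'.measurable_signal hM'.markov (hI.Ici_subset ha) (hI'.Ici_subset ha') hσ hA) hA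
  · exact ((hf.comp ((measurable_pi_apply r).comp measurable_fst)).sub
      (hg.comp (measurable_observedPath hh κ r))).pow_const 2
  · rw [← sq_abs]
    gcongr
    exact (abs_sub _ _).trans (add_le_add (hC _) (hgC _))

/-- By Lévy's upward theorem, the error of estimation from the observations on `[-k, 0]` tends to the
error of estimation from the infinite past. -/
theorem IsFilteringModel.tendsto_windowError [IsProbabilityMeasure P]
    (hM : IsFilteringModel Set.univ K h X B P) (hh : Measurable h) (κ : ℝ)
    {f : E → ℝ} (hf : Measurable f) {C : ℝ} (hC : ∀ x, |f x| ≤ C) :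
    Tendsto (fun k : ℕ => ∫ ω, (f (X 0 ω) - (P[fun ω' => f (X 0 ω') |
        obsSigma (observation h X B κ) (-(k : ℝ)) 0]) ω) ^ 2 ∂P) atTop
      (𝓝 (stationaryError P h X B f κ)) := by
  obtain ⟨ω₀⟩ := nonempty_of_isProbabilityMeasure P
  have : Nonempty E := ⟨X 0 ω₀⟩
  have hC0 : 0 ≤ C := (abs_nonneg _).trans (hC (X 0 ω₀))
  set Y := observation h X B κ
  have hY : ∀ t ∈ (Set.univ : Set ℝ), Measurable (Y t) := fun t ht =>
    hM.measurable_observation isUpperSet_univ (Set.mem_univ _) hh κ ht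
  let ℱ : Filtration ℕ ‹MeasurableSpace Ω› :=
    { seq := fun k => obsSigma Y (-(k : ℝ)) 0
      mono' := fun k l hkl => obsSigma_mono Y (by simpa using hkl) le_rfl
      le' := fun k => obsSigma_le isUpperSet_univ hY (Set.mem_univ _) }
  have hsup : ⨆ k, ℱ k = obsSigmaPast Y 0 := iSup_obsSigma_neg_natCast Y
  have hlim := tendsto_ae_condExp (μ := P) (ℱ := ℱ) fun ω => f (X 0 ω)
  rw [hsup] at hlim
  have hX : Measurable fun ω => f (X 0 ω) := hf.comp (hM.measurable_signal 0 (Set.mem_univ _))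
  refine tendsto_integral_of_dominated_convergence (fun _ => (C + C) ^ 2) (fun k => ?_)
    (integrable_const _) (fun k => ?_) ?_
  · exact (hX.sub ((stronglyMeasurable_condExp.mono (ℱ.le k)).measurable)).pow_const 2
      |>.aestronglyMeasurable
  · have : ∀ᵐ ω ∂P, |(P[fun ω' => f (X 0 ω') | ℱ k]) ω| ≤ C :=
      ae_bdd_abs_condExp_of_ae_bdd_abs (ae_of_all _ fun ω => hC _)
    filter_upwards [this] with ω hω
    rw [norm_pow]
    gcongr
    exact (norm_sub_le _ _).trans (add_le_add (hC _) hω)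
  · filter_upwards [hlim] with ω hω
    exact (tendsto_const_nhds.sub hω).pow 2

end Model

end NonlinearFilter

theorem lemma2p2
    {E : Type*} [TopologicalSpace E] [PolishSpace E] [MeasurableSpace E] [BorelSpace E] {n : ℕ}
    -- the transition probabilities of the signal and the observation function
    (K : ℝ≥0 → Kernel E E) [∀ t, IsMarkovKernel (K t)]
    (h : E → EuclideanSpace ℝ (Fin n)) (hh : Measurable h)
    -- the stationary two-sided model under `P`
    {Ω : Type*} [MeasurableSpace Ω] (P : Measure Ω) [IsProbabilityMeasure P]
    (X : ℝ → Ω → E) (B : ℝ → Ω → EuclideanSpace ℝ (Fin n))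
    (hmodel : NonlinearFilter.IsFilteringModel Set.univ K h X B P)
    (hstat : NonlinearFilter.IsStationaryProcess X P)
    (π : Measure E) [IsProbabilityMeasure π] (hπ : P.map (X 0) = π)
    -- the one-sided model started from `μ`
    (μ : Measure E) [IsProbabilityMeasure μ]
    {Ωμ : Type*} [MeasurableSpace Ωμ] (Pμ : Measure Ωμ) [IsProbabilityMeasure Pμ]
    (Xμ : ℝ → Ωμ → E) (Bμ : ℝ → Ωμ → EuclideanSpace ℝ (Fin n))
    (hmodelμ : NonlinearFilter.IsFilteringModel (Set.Ici 0) K h Xμ Bμ Pμ)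
    (hμ : Pμ.map (Xμ 0) = μ)
    -- convergence in total variation of the law of the signal to the stationary law
    (hTV : Tendsto
      (fun t : ℝ =>
        ((Pμ.map (Xμ t)).toSignedMeasure - π.toSignedMeasure).totalVariation.real Set.univ)
      atTop (𝓝 0))
    -- a bounded measurable test function
    (f : E → ℝ) (hf : Measurable f) (hfb : ∃ C : ℝ, ∀ x, |f x| ≤ C) :
    (∀ κ : ℝ, 0 ≤ κ →
      limsup (fun t : ℝ => ((NonlinearFilter.filterError Pμ h Xμ Bμ f κ t : ℝ) : EReal)) atTop
        ≤ ((NonlinearFilter.stationaryError P h X B f κ : ℝ) : EReal)) ∧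
    (Tendsto (fun κ : ℝ => NonlinearFilter.stationaryError P h X B f κ) (𝓝[>] 0) (𝓝 0) →
      Tendsto
        (fun κ : ℝ =>
          limsup (fun t : ℝ => ((NonlinearFilter.filterError Pμ h Xμ Bμ f κ t : ℝ) : EReal)) atTop)
        (𝓝[>] 0) (𝓝 0)) := by
  obtain ⟨C, hC⟩ := hfb
  have hIci : IsUpperSet (Set.Ici (0 : ℝ)) := isUpperSet_Ici 0
  have main : ∀ κ : ℝ,
      limsup (fun t : ℝ => ((NonlinearFilter.filterError Pμ h Xμ Bμ f κ t : ℝ) : EReal)) atTop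
        ≤ ((NonlinearFilter.stationaryError P h X B f κ : ℝ) : EReal) := by
    intro κ
    refine ge_of_tendsto' (continuous_coe_real_ereal.continuousAt.tendsto.comp
      (hmodel.tendsto_windowError hh κ hf hC)) fun k => ?_
    set w := ∫ ω, (f (X 0 ω) - (P[fun ω' => f (X 0 ω') |
        NonlinearFilter.obsSigma (NonlinearFilter.observation h X B κ) (-(k : ℝ)) 0]) ω) ^ 2 ∂P
    -- compare the window `[t - k, t]` under `Pμ` with the window `[-k, 0]` under `P`
    have hbound : ∀ t : ℝ, (k : ℝ) ≤ t → NonlinearFilter.filterError Pμ h Xμ Bμ f κ t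
        ≤ w + (C + C) ^ 2 * ((Pμ.map (Xμ (t - k))).toSignedMeasure
          - π.toSignedMeasure).totalVariation.real Set.univ := by
      intro t ht
      have hk : (0 : ℝ) ≤ k := k.cast_nonneg
      have hmem : t - k ∈ Set.Ici (0 : ℝ) := by simpa using ht
      have hlaw : P.map (X (-(k : ℝ))) = π := by
        have := ((hstat (-(k : ℝ))).comp (measurable_pi_apply (0 : ℝ))).map_eq
        simpa [Function.comp_def, hπ] using this
      have := hmodelμ.integral_sq_sub_condExp_le_add hIci Set.self_mem_Ici hmodel
        isUpperSet_univ (Set.mem_univ _) hh κ hmem (a' := -(k : ℝ)) (Set.mem_univ _) (k : ℝ≥0)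
        (by rw [hlaw]; exact NonlinearFilter.measure_le_add_totalVariation _ _) hf hC
        (c := 0) Set.self_mem_Ici hmem
      simpa [NonlinearFilter.filterError, w] using this
    have hlim : Tendsto (fun t : ℝ => ((w + (C + C) ^ 2 *
        ((Pμ.map (Xμ (t - k))).toSignedMeasure
          - π.toSignedMeasure).totalVariation.real Set.univ : ℝ) : EReal)) atTop (𝓝 (w : EReal)) := by
      refine continuous_coe_real_ereal.continuousAt.tendsto.comp ?_
      have := (hTV.comp (tendsto_atTop_add_const_right atTop (-(k : ℝ)) tendsto_id)).const_mul
        ((C + C) ^ 2) |>.const_add w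
      simpa [Function.comp_def, sub_eq_add_neg] using this
    refine (limsup_le_limsup ?_).trans hlim.limsup_eq.le
    filter_upwards [eventually_ge_atTop (k : ℝ)] with t ht
    exact EReal.coe_le_coe_iff.2 (hbound t ht)
  refine ⟨fun κ _ => main κ, fun hlim => ?_⟩
  refine tendsto_of_tendsto_of_tendsto_of_le_of_le tendsto_const_nhds
    (continuous_coe_real_ereal.continuousAt.tendsto.comp hlim) (fun κ => ?_) main
  refine le_limsup_of_frequently_le (Eventually.of_forall fun t => ?_).frequently
  exact EReal.coe_nonneg.2 (integral_nonneg fun ω => sq_nonneg _)
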